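/- Let $m,k,m_I,k_I\ge 1$ be integers and put $\tau_1=\lceil m/m_I\rceil\lceil k/k_I\rceil$. A master uses $n=\sum_{u=1}^c n_u$ workers grouped in $c\ge 1$ clusters, cluster $u$ having $n_u$ workers, rate $\lambda_u>0$ and shift $s_u\ge 0$, where cluster $1$ is the fastest ($\lambda_u\le\lambda_1$ for all $u$) and $\lambda_u s_u=t_m$ does not depend on $u$. Every worker has to compute $\tau_1$ tasks. Under the cluster-dependent additive service time model (model 2), all task times, over all workers and tasks, are independent, and each task time of a worker in cluster $u$ has the shifted exponential distribution with shift $s_u/(km)$ and rate $\lambda_u km$. In the KES scheme that tolerates $n_s$ stragglers, $0\le n_s<n$, the waiting time $T_{\mathrm{KES}}$ of the master is the first time at which $n-n_s$ workers have each completed all of their $\tau_1$ tasks, i.e. the $(n-n_s)$-th smallest of the $n$ total times of the workers. Then $T_{\mathrm{KES}}$ is integrable and $$\mathbb E[T_{\mathrm{KES}}]\ \ge\ \frac{s_1}{k_I m_I}+\Phi_I(n),$$ where $$\Phi_I(n)=\frac{(n-n_s)\binom{n}{n_s}}{\lambda_1 km\,(\tau_1-1)!}\sum_{j=0}^{n-n_s-1}(-1)^j\binom{n-n_s-1}{j}\sum_{\ell=0}^{(\tau_1-1)(n_s+j)}a_\ell(\tau_1,n_s+j)\,\frac{(\tau_1+\ell)!}{(n_s+j+1)^{\tau_1+\ell+1}}$$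 and $a_\ell(o,p)$ is the coefficient of $x^\ell$ in $\bigl(\sum_{i=0}^{o-1}x^i/i!\bigr)^p$. Moreover, for every real $\sigma$, the $(n-n_s)$-th order statistic of $n$ i.i.d. shifted Erlang variables with shape $\tau_1$, rate $\lambda_1 km$ and shift $\sigma$ is integrable with mean $\sigma+\Phi_I(n)$ (so $\Phi_I(n)$ itself is the mean for shift $0$), and for the shift $\sigma=\tau_1 s_1/(km)$ this mean is also a lower bound for $\mathbb E[T_{\mathrm{KES}}]$. -/

import Mathlib

open MeasureTheory ProbabilityTheory

noncomputable section

/-- Law of a shifted exponential variable with shift `s` and rate `r`, i.e. of `s + Y` with `Y`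
exponential of rate `r`: it has density `r * exp (-r * (x - s))` on `x > s`. -/
def shiftedExp (s r : ℝ) : Measure ℝ :=
  (expMeasure r).map (fun x => s + x)

/-- Law of a shifted Erlang variable with shape `a`, rate `r` and shift `s`, i.e. of `s + G` with
`G` Erlang (gamma with integer shape `a`) of rate `r`. -/
def shiftedErlang (a : ℕ) (r s : ℝ) : Measure ℝ :=
  (gammaMeasure (a : ℝ) r).map (fun x => s + x)

/-- The `d`-th order statistic (the `d`-th smallest value, counted with multiplicity) of a finite
family of reals, for `1 ≤ d ≤` size of the family: the first time `t` at which at least `d` of the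
values are at most `t`. -/
def orderStat {ι : Type*} [Fintype ι] (d : ℕ) (x : ι → ℝ) : ℝ :=
  sInf {t : ℝ | d ≤ Nat.card {i : ι // x i ≤ t}}

/-- The workers: the `i`-th worker of cluster `u`, where cluster `u` has `size u` workers. -/
abbrev Worker {c : ℕ} (size : Fin c → ℕ) : Type := (u : Fin c) × Fin (size u)

/-- The number `⌈m / m_I⌉ ⌈k / k_I⌉` of tasks sent to every worker. -/
def numTasks (m k mI kI : ℕ) : ℕ :=
  ⌈(m : ℝ) / (mI : ℝ)⌉₊ * ⌈(k : ℝ) / (kI : ℝ)⌉₊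

/-- Cluster-dependent additive service time model, for `τ` tasks per worker: `X w j` is the time
that worker `w` spends on its `j`-th task. All these times are independent, and the time of a worker
of cluster `u` is shifted exponential with shift `s u / (k m)` and rate `lam u * k * m`. -/
structure AdditiveServiceTime {c : ℕ} (size : Fin c → ℕ) (m k τ : ℕ) (s lam : Fin c → ℝ)
    {Ω : Type*} [MeasurableSpace Ω] (μ : Measure Ω)
    (X : Worker size → Fin τ → Ω → ℝ) : Prop where
  law : ∀ (w : Worker size) (j : Fin τ),
    HasLaw (X w j) (shiftedExp (s w.1 / ((k : ℝ) * m)) (lam w.1 * k * m)) μ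
  indep : iIndepFun (fun p : Worker size × Fin τ => X p.1 p.2) μ

/-- The time at which a worker has computed all of its `τ` tasks. -/
def workerTime {c : ℕ} {size : Fin c → ℕ} {τ : ℕ} {Ω : Type*}
    (X : Worker size → Fin τ → Ω → ℝ) (w : Worker size) (ω : Ω) : ℝ :=
  ∑ j, X w j ω

/-- The waiting time of the master for a scheme that tolerates `ns` stragglers: the first time at
which all but `ns` of the `∑ u, size u` workers have computed all of their tasks. -/
def waitingTimeKES {c : ℕ} {size : Fin c → ℕ} {τ : ℕ} {Ω : Type*} (ns : ℕ)
    (X : Worker size → Fin τ → Ω → ℝ) (ω : Ω) : ℝ :=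
  orderStat ((∑ u, size u) - ns) (fun w => workerTime X w ω)

/-- The coefficient of `x ^ l` in the expansion of `(∑ i < o, x ^ i / i!) ^ p`. -/
def expCoeff (o p l : ℕ) : ℝ :=
  ((∑ i ∈ Finset.range o,
    Polynomial.C (1 / (i.factorial : ℝ)) * (Polynomial.X : Polynomial ℝ) ^ i) ^ p).coeff l

/-- The alternating sum `Φ_I(n)`, for `n` workers, `ns < n` stragglers, `τ ≥ 1` tasks per worker and
rate `r`. -/
def PhiI (n ns τ : ℕ) (r : ℝ) : ℝ :=
  (((n - ns : ℕ) : ℝ) * (n.choose ns : ℝ)) / (r * ((τ - 1).factorial : ℝ)) *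
    ∑ j ∈ Finset.range (n - ns), (-1 : ℝ) ^ j * ((n - ns - 1).choose j : ℝ) *
      ∑ l ∈ Finset.range ((τ - 1) * (ns + j) + 1),
        expCoeff τ (ns + j) l * ((τ + l).factorial : ℝ) / ((ns : ℝ) + j + 1) ^ (τ + l + 1)

end

/-! The bound is a coupling on the given probability space. Multiply the total time of each worker
in cluster `u` by `lam u / lam 0 ≤ 1`. Since `lam u * s u` is constant, this rescaling turns every
task time into a shifted exponential with the parameters of the fastest cluster, so the rescaled
totals are i.i.d. shifted Erlang (`AdditiveServiceTime.map_scaled_workerTime`). Totals are almost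
surely nonnegative, so rescaling only lowers them; order statistics are monotone, hence the mean
waiting time is at least the mean of the i.i.d. order statistic.

That mean is computed exactly. The distribution function of an order statistic is an upper tail of
the Bernstein basis evaluated at the Erlang distribution function. Its derivative telescopes to one
Bernstein term, which gives a density (`map_orderStat_pi_gammaMeasure`). Expanding that density
binomially, and the powers of the Erlang tail through `expCoeff`, leaves monomials times
exponentials; integrating them termwise yields `PhiI`. A shift passes through the order statistic
unchanged. The bound with `s 0 / (kI * mI)` then follows because rounding up only enlarges the
number of tasks. -/

section OrderStatistics

/-! ### Order statistics of finite families and of i.i.d. samples -/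

variable {ι : Type*} [Fintype ι]

/-- An order statistic is attained: it is one of the values, and it is the least time at which at
least `d` of the values have occurred. -/
lemma exists_isLeast_orderStat {d : ℕ} (hd : 1 ≤ d) (hdn : d ≤ Fintype.card ι) (x : ι → ℝ) :
    ∃ i, orderStat d x = x i ∧
      IsLeast {t : ℝ | d ≤ Nat.card {i : ι // x i ≤ t}} (orderStat d x) := by
  classical
  set S := {t : ℝ | d ≤ Nat.card {i : ι // x i ≤ t}} with hS
  have hcard (t : ℝ) : Nat.card {i : ι // x i ≤ t} = (Finset.univ.filter (x · ≤ t)).card := by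
    rw [Nat.card_eq_fintype_card, Fintype.card_subtype]
  -- The largest value not exceeding `t` already has as many values below it as `t` has, so the
  -- infimum can be sought among the finitely many values.
  have key : ∀ t ∈ S, ∃ i, x i ≤ t ∧ x i ∈ S := by
    intro t ht
    have hne : (Finset.univ.filter (x · ≤ t)).Nonempty := by
      rw [← Finset.card_pos, ← hcard]
      exact hd.trans ht
    obtain ⟨i, hi, hmax⟩ := Finset.exists_max_image _ x hne
    refine ⟨i, (Finset.mem_filter.1 hi).2, ?_⟩
    simp only [hS, Set.mem_ofPred_eq, hcard] at ht ⊢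
    exact ht.trans (Finset.card_le_card fun j hj ↦
      Finset.mem_filter.2 ⟨Finset.mem_univ j, hmax j hj⟩)
  obtain ⟨M, hM⟩ := (Set.finite_range x).bddAbove
  have hMS : M ∈ S := by
    simp only [hS, Set.mem_ofPred_eq, hcard]
    rw [Finset.filter_true_of_mem fun i _ ↦ hM ⟨i, rfl⟩]
    exact hdn
  have hne : (Finset.univ.filter (x · ∈ S)).Nonempty := by
    obtain ⟨i, -, hi⟩ := key M hMS
    exact ⟨i, Finset.mem_filter.2 ⟨Finset.mem_univ i, hi⟩⟩
  obtain ⟨i, hi, hmin⟩ := Finset.exists_min_image _ x hne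
  have hleast : IsLeast S (x i) := by
    refine ⟨(Finset.mem_filter.1 hi).2, fun t ht ↦ ?_⟩
    obtain ⟨j, hj, hjS⟩ := key t ht
    exact (hmin j (Finset.mem_filter.2 ⟨Finset.mem_univ j, hjS⟩)).trans hj
  have : orderStat d x = x i := hleast.csInf_eq
  exact ⟨i, this, this ▸ hleast⟩

/-- Valid because the infimum is attained. Monotonicity, translation and measurability are all read
off from this count. -/
lemma orderStat_le_iff [DecidableEq ι] {d : ℕ} (hd : 1 ≤ d) (hdn : d ≤ Fintype.card ι) (x : ι → ℝ)
    (t : ℝ) : orderStat d x ≤ t ↔ d ≤ (Finset.univ.filter (x · ≤ t)).card := by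
  have hcard (t : ℝ) : Nat.card {i : ι // x i ≤ t} = (Finset.univ.filter (x · ≤ t)).card := by
    rw [Nat.card_eq_fintype_card, Fintype.card_subtype]
  obtain ⟨-, -, hmem, hle⟩ := exists_isLeast_orderStat hd hdn x
  simp only [Set.mem_ofPred_eq, hcard] at hmem
  refine ⟨fun h ↦ hmem.trans (Finset.card_le_card ?_), fun h ↦ hle ?_⟩
  · exact Finset.monotone_filter_right _ fun i _ hi ↦ hi.trans h
  · simpa only [Set.mem_ofPred_eq, hcard] using h

lemma orderStat_mono {d : ℕ} (hd : 1 ≤ d) (hdn : d ≤ Fintype.card ι) {x y : ι → ℝ} (h : x ≤ y) :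
    orderStat d x ≤ orderStat d y := by
  classical
  rw [orderStat_le_iff hd hdn]
  refine ((orderStat_le_iff hd hdn y _).1 le_rfl).trans (Finset.card_le_card ?_)
  exact Finset.monotone_filter_right _ fun i _ hi ↦ (h i).trans hi

lemma orderStat_const_add {d : ℕ} (hd : 1 ≤ d) (hdn : d ≤ Fintype.card ι) (σ : ℝ) (x : ι → ℝ) :
    orderStat d (fun i ↦ σ + x i) = σ + orderStat d x := by
  classical
  refine eq_of_forall_ge_iff fun t ↦ ?_
  rw [orderStat_le_iff hd hdn, ← le_sub_iff_add_le', orderStat_le_iff hd hdn]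
  simp_rw [le_sub_iff_add_le']

/-- The order statistic is one of the values; the bound serves as integrable majorant. -/
lemma abs_orderStat_le_sum {d : ℕ} (hd : 1 ≤ d) (hdn : d ≤ Fintype.card ι) (x : ι → ℝ) :
    |orderStat d x| ≤ ∑ i, |x i| := by
  obtain ⟨i, hi, -⟩ := exists_isLeast_orderStat hd hdn x
  rw [hi]
  exact Finset.single_le_sum (f := fun i ↦ |x i|) (fun i _ ↦ abs_nonneg _) (Finset.mem_univ i)

/-- The vectors whose coordinates at most `t` are exactly those indexed by `s`. -/
lemma filter_le_eq_iff_mem_pi [DecidableEq ι] (s : Finset ι) (t : ℝ) (x : ι → ℝ) :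
    Finset.univ.filter (x · ≤ t) = s ↔
      x ∈ Set.univ.pi fun i ↦ if i ∈ s then Set.Iic t else Set.Ioi t := by
  simp only [Finset.ext_iff, Finset.mem_filter, Finset.mem_univ, true_and, Set.mem_univ_pi]
  refine forall_congr' fun i ↦ ?_
  by_cases hi : i ∈ s <;> simp [hi]

lemma measurableSet_filter_le_eq [DecidableEq ι] (s : Finset ι) (t : ℝ) :
    MeasurableSet {x : ι → ℝ | Finset.univ.filter (x · ≤ t) = s} := by
  simp_rw [filter_le_eq_iff_mem_pi]
  refine MeasurableSet.univ_pi fun i ↦ ?_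
  split_ifs
  exacts [measurableSet_Iic, measurableSet_Ioi]

/-- Splitting by the exact set of coordinates at most `t` gives finitely many disjoint boxes, whose
product measure factorizes. -/
lemma orderStat_preimage_Iic [DecidableEq ι] {d : ℕ} (hd : 1 ≤ d) (hdn : d ≤ Fintype.card ι)
    (t : ℝ) : (orderStat d : (ι → ℝ) → ℝ) ⁻¹' Set.Iic t =
      ⋃ s ∈ (Finset.univ : Finset (Finset ι)).filter (d ≤ ·.card),
        {x : ι → ℝ | Finset.univ.filter (x · ≤ t) = s} := by
  ext x
  simp [orderStat_le_iff hd hdn]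

lemma measurable_orderStat {d : ℕ} (hd : 1 ≤ d) (hdn : d ≤ Fintype.card ι) :
    Measurable (orderStat d : (ι → ℝ) → ℝ) := by
  classical
  refine measurable_of_Iic fun t ↦ ?_
  rw [orderStat_preimage_Iic hd hdn]
  exact Finset.measurableSet_biUnion _ fun s _ ↦ measurableSet_filter_le_eq s t

lemma integrable_orderStat_comp {Ω : Type*} [MeasurableSpace Ω] {μ : Measure Ω} {d : ℕ}
    (hd : 1 ≤ d) (hdn : d ≤ Fintype.card ι) {Y : ι → Ω → ℝ} (hY : ∀ i, Integrable (Y i) μ) :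
    Integrable (fun ω ↦ orderStat d fun i ↦ Y i ω) μ := by
  refine (integrable_finsetSum Finset.univ fun i _ ↦ (hY i).abs).mono' ?_ ?_
  · exact ((measurable_orderStat hd hdn).comp_aemeasurable
      (aemeasurable_pi_lambda _ fun i ↦ (hY i).aemeasurable)).aestronglyMeasurable
  · exact Filter.Eventually.of_forall fun ω ↦ abs_orderStat_le_sum hd hdn _

lemma pi_real_filter_le_eq [DecidableEq ι] (ν : Measure ℝ) [IsProbabilityMeasure ν]
    (s : Finset ι) (t : ℝ) :
    (Measure.pi fun _ : ι ↦ ν).real {x : ι → ℝ | Finset.univ.filter (x · ≤ t) = s} =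
      ν.real (Set.Iic t) ^ s.card * (1 - ν.real (Set.Iic t)) ^ (Fintype.card ι - s.card) := by
  simp_rw [filter_le_eq_iff_mem_pi]
  rw [Set.ofPred_mem_eq, measureReal_def, Measure.pi_pi, ENNReal.toReal_prod]
  have (i : ι) : (ν (if i ∈ s then Set.Iic t else Set.Ioi t)).toReal =
      if i ∈ s then ν.real (Set.Iic t) else 1 - ν.real (Set.Iic t) := by
    split_ifs with h
    · rfl
    · rw [← probReal_compl_eq_one_sub measurableSet_Iic, Set.compl_Iic]
      rfl
  simp_rw [this, Finset.prod_ite, Finset.prod_const]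
  congr 2
  · simp
  · rw [Finset.filter_not, Finset.card_sdiff_of_subset (by simp)]
    simp

/-- The distribution function of an order statistic of an i.i.d. sample. -/
lemma pi_real_orderStat_preimage_Iic (ν : Measure ℝ) [IsProbabilityMeasure ν] {d : ℕ}
    (hd : 1 ≤ d) (hdn : d ≤ Fintype.card ι) (t : ℝ) :
    (Measure.pi fun _ : ι ↦ ν).real (orderStat d ⁻¹' Set.Iic t) =
      ∑ i ∈ Finset.Icc d (Fintype.card ι),
        (bernsteinPolynomial ℝ (Fintype.card ι) i).eval (ν.real (Set.Iic t)) := by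
  classical
  rw [orderStat_preimage_Iic hd hdn, measureReal_biUnion_finset]
  · simp_rw [pi_real_filter_le_eq]
    -- Sets of equal size `i` have equal probability, and counting them supplies the binomial
    -- coefficient of the Bernstein polynomial.
    rw [← Finset.sum_fiberwise_of_maps_to (t := Finset.Icc d (Fintype.card ι)) (g := Finset.card)]
    · refine Finset.sum_congr rfl fun i hi ↦ ?_
      rw [Finset.sum_congr rfl (g := fun _ ↦ ν.real (Set.Iic t) ^ i *
        (1 - ν.real (Set.Iic t)) ^ (Fintype.card ι - i)), Finset.sum_const, nsmul_eq_mul]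
      · have : {s ∈ (Finset.univ : Finset (Finset ι)).filter (d ≤ ·.card) | s.card = i} =
            Finset.powersetCard i Finset.univ := by
          ext s
          simp only [Finset.mem_filter, Finset.mem_univ, true_and, Finset.mem_powersetCard,
            Finset.subset_univ, and_iff_right_iff_imp]
          rintro rfl
          exact (Finset.mem_Icc.1 hi).1
        rw [this, Finset.card_powersetCard, Finset.card_univ]
        simp [bernsteinPolynomial, mul_assoc]
      · intro s hs
        rw [(Finset.mem_filter.1 hs).2]
    · intro s hs
      exact Finset.mem_Icc.2 ⟨(Finset.mem_filter.1 hs).2, Finset.card_le_univ s⟩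
  · intro s _ s' _ hne
    refine Set.disjoint_left.2 fun x hx hx' ↦ hne ?_
    exact (show Finset.univ.filter (x · ≤ t) = s from hx).symm.trans hx'
  · exact fun s _ ↦ measurableSet_filter_le_eq s t

/-- The upper tail of the Bernstein basis has a telescoping derivative. -/
lemma derivative_sum_Icc_bernsteinPolynomial {n d : ℕ} (hd : 1 ≤ d) (hdn : d ≤ n) :
    Polynomial.derivative (∑ i ∈ Finset.Icc d n, bernsteinPolynomial ℝ n i) =
      n * bernsteinPolynomial ℝ (n - 1) (d - 1) := by
  obtain ⟨d, rfl⟩ := Nat.exists_eq_add_of_le' hd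
  obtain ⟨k, rfl⟩ := Nat.exists_eq_add_of_le hdn
  have : Finset.Icc (d + 1) (d + 1 + k) = (Finset.range (k + 1)).map
      (addLeftEmbedding (d + 1)) := by
    rw [Finset.range_eq_Ico, Finset.map_add_left_Ico]
    ext; simp; omega
  rw [this, Finset.sum_map, Polynomial.derivative_sum]
  have h (j : ℕ) : Polynomial.derivative (bernsteinPolynomial ℝ (d + 1 + k)
      (addLeftEmbedding (d + 1) j)) = (d + 1 + k : ℕ) *
        (bernsteinPolynomial ℝ (d + k) (d + j) - bernsteinPolynomial ℝ (d + k) (d + (j + 1))) := by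
    rw [addLeftEmbedding_apply, add_right_comm d 1 j, bernsteinPolynomial.derivative_succ]
    congr 3 <;> omega
  -- The differences telescope; the final term vanishes because its index exceeds the degree.
  simp_rw [h]
  rw [← Finset.mul_sum, Finset.sum_range_sub' (fun j ↦ bernsteinPolynomial ℝ (d + k) (d + j)),
    bernsteinPolynomial.eq_zero_of_lt ℝ (show d + k < d + (k + 1) by omega)]
  simp only [add_zero, sub_zero, Nat.add_sub_cancel]
  congr 2
  omega

end OrderStatistics

/-! ### The Erlang law: tail, density, integrability and characteristic function -/

section Erlang

/-- The tail `e ^ (-y) * ∑ i < a, y ^ i / i!` of the Erlang distribution of shape `a` and rate `1`. -/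
noncomputable def erlangTail (a : ℕ) (y : ℝ) : ℝ :=
  Real.exp (-y) * ∑ i ∈ Finset.range a, y ^ i / (i.factorial : ℝ)

/-- The derivatives of consecutive terms of the tail cancel, leaving only the contribution of the
last term. -/
lemma hasDerivAt_erlangTail (a : ℕ) (y : ℝ) :
    HasDerivAt (erlangTail (a + 1)) (-(y ^ a / (a.factorial : ℝ) * Real.exp (-y))) y := by
  have hexp : HasDerivAt (fun y : ℝ ↦ Real.exp (-y)) (-Real.exp (-y)) y := by
    simpa using (hasDerivAt_neg y).exp
  induction a with
  | zero =>
    have h0 : erlangTail (0 + 1) = fun y ↦ Real.exp (-y) := by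
      funext y
      simp [erlangTail]
    rw [h0]
    exact hexp.congr_deriv (by simp)
  | succ a ih =>
    have h1 : erlangTail (a + 1 + 1) =
        fun y ↦ erlangTail (a + 1) y + Real.exp (-y) * (y ^ (a + 1) / ((a + 1).factorial : ℝ)) := by
      funext y
      rw [erlangTail, Finset.sum_range_succ, mul_add, erlangTail]
    rw [h1]
    refine (ih.fun_add (hexp.fun_mul ((hasDerivAt_pow (a + 1) y).div_const _))).congr_deriv ?_
    rw [Nat.factorial_succ, Nat.add_sub_cancel]
    push_cast
    field_simp
    ring

lemma erlangTail_zero (a : ℕ) : erlangTail (a + 1) 0 = 1 := by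
  simp [erlangTail, Finset.sum_range_succ']

lemma erlangTail_nonneg (a : ℕ) {y : ℝ} (hy : 0 ≤ y) : 0 ≤ erlangTail a y := by
  unfold erlangTail
  positivity

lemma erlangTail_le_one (a : ℕ) {y : ℝ} (hy : 0 ≤ y) : erlangTail a y ≤ 1 := by
  rw [erlangTail, Real.exp_neg, inv_mul_le_one₀ (Real.exp_pos _)]
  exact Real.sum_le_exp_of_nonneg hy a

/-- The density of the Erlang distribution of shape `a + 1`, without its restriction to `x ≥ 0`. -/
noncomputable def erlangDensity (a : ℕ) (r x : ℝ) : ℝ :=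
  r * ((r * x) ^ a / (a.factorial : ℝ) * Real.exp (-(r * x)))

lemma erlangDensity_nonneg (a : ℕ) {r x : ℝ} (hr : 0 ≤ r) (hx : 0 ≤ x) :
    0 ≤ erlangDensity a r x := by
  unfold erlangDensity
  positivity

lemma continuous_erlangDensity (a : ℕ) (r : ℝ) : Continuous (erlangDensity a r) := by
  unfold erlangDensity
  fun_prop

lemma hasDerivAt_one_sub_erlangTail (a : ℕ) (r x : ℝ) :
    HasDerivAt (fun x ↦ 1 - erlangTail (a + 1) (r * x)) (erlangDensity a r x) x := by
  refine (((hasDerivAt_erlangTail a (r * x)).comp x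
    ((hasDerivAt_id x).const_mul r)).const_sub 1).congr_deriv ?_
  rw [erlangDensity]
  ring

lemma gammaPDFReal_succ (a : ℕ) (r : ℝ) {x : ℝ} (hx : 0 ≤ x) :
    gammaPDFReal ((a + 1 : ℕ) : ℝ) r x = erlangDensity a r x := by
  rw [gammaPDFReal, if_pos hx, erlangDensity, Nat.cast_succ, Real.Gamma_nat_eq_factorial,
    add_sub_cancel_right, Real.rpow_natCast, ← Nat.cast_succ, Real.rpow_natCast, pow_succ]
  ring

lemma gammaMeasure_succ (a : ℕ) (r : ℝ) :
    gammaMeasure ((a + 1 : ℕ) : ℝ) r =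
      (volume.restrict (Set.Ioi 0)).withDensity fun x ↦ ENNReal.ofReal (erlangDensity a r x) := by
  rw [gammaMeasure, ← withDensity_indicator measurableSet_Ioi]
  refine withDensity_congr_ae ?_
  -- At `0` the density may be nonzero (shape `1`) while the indicator of `Ioi 0` vanishes; a single
  -- point is null.
  filter_upwards [Measure.ae_ne volume (0 : ℝ)] with x hx
  rcases lt_or_gt_of_ne hx with h | h
  · rw [gammaPDF_of_neg h, Set.indicator_of_notMem (by simpa using h.le)]
  · rw [gammaPDF, gammaPDFReal_succ a r h.le, Set.indicator_of_mem (by simpa using h)]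

/-- If a function `G` vanishing at `0` has a derivative `g` that is continuous, and nonnegative on
`x ≥ 0`, then `g` on `x > 0` is the density of a measure with distribution function `G`. -/
lemma withDensity_Iic_of_hasDerivAt {G g : ℝ → ℝ} (hG : ∀ x, HasDerivAt G (g x) x)
    (hg : Continuous g) (h0 : G 0 = 0) (hpos : ∀ x, 0 ≤ x → 0 ≤ g x) (t : ℝ) :
    ((volume.restrict (Set.Ioi 0)).withDensity fun x ↦ ENNReal.ofReal (g x)) (Set.Iic t) =
      ENNReal.ofReal (if 0 ≤ t then G t else 0) := by
  rw [withDensity_apply _ measurableSet_Iic, Measure.restrict_restrict measurableSet_Iic,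
    Set.inter_comm, Set.Ioi_inter_Iic]
  split_ifs with ht
  · rw [← ofReal_integral_eq_lintegral_ofReal, ← intervalIntegral.integral_of_le ht,
      intervalIntegral.integral_eq_sub_of_hasDerivAt (fun x _ ↦ hG x) (hg.intervalIntegrable _ _),
      h0, sub_zero]
    · exact (hg.integrableOn_Icc).mono_set Set.Ioc_subset_Icc_self
    · filter_upwards [self_mem_ae_restrict measurableSet_Ioc] with x hx using hpos x hx.1.le
  · rw [Set.Ioc_eq_empty (fun h ↦ ht h.le)]
    simp

lemma gammaMeasure_succ_real_Iic (a : ℕ) {r : ℝ} (hr : 0 ≤ r) (t : ℝ) :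
    (gammaMeasure ((a + 1 : ℕ) : ℝ) r).real (Set.Iic t) =
      if 0 ≤ t then 1 - erlangTail (a + 1) (r * t) else 0 := by
  rw [measureReal_def, gammaMeasure_succ,
    withDensity_Iic_of_hasDerivAt (hasDerivAt_one_sub_erlangTail a r)
      (continuous_erlangDensity a r) (by simp [erlangTail_zero])
      (fun x hx ↦ erlangDensity_nonneg a hr hx), ENNReal.toReal_ofReal]
  split_ifs with ht
  · exact sub_nonneg.2 (erlangTail_le_one _ (mul_nonneg hr ht))
  · rfl

lemma integrableOn_pow_mul_exp_neg_mul (n : ℕ) {b : ℝ} (hb : 0 < b) :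
    IntegrableOn (fun x : ℝ ↦ x ^ n * Real.exp (-(b * x))) (Set.Ioi 0) := by
  refine (integrableOn_rpow_mul_exp_neg_mul_rpow (s := n) (p := 1) (b := b)
    (by have := n.cast_nonneg (α := ℝ); linarith) one_pos hb).congr_fun
    (fun x _ ↦ by simp) measurableSet_Ioi

lemma integral_pow_mul_exp_neg_mul (n : ℕ) {b : ℝ} (hb : 0 < b) :
    ∫ x in Set.Ioi (0 : ℝ), x ^ n * Real.exp (-(b * x)) = n.factorial / b ^ (n + 1) := by
  have := Real.integral_rpow_mul_exp_neg_mul_Ioi (a := (n + 1 : ℕ)) (by positivity) hb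
  rw [Nat.cast_succ, Real.Gamma_nat_eq_factorial, ← Nat.cast_succ, Real.rpow_natCast] at this
  simp only [Nat.cast_succ, add_sub_cancel_right, Real.rpow_natCast] at this
  rw [this, Nat.succ_eq_add_one, one_div, inv_pow]
  ring

/-- The Laplace transform of `x ^ n` at a complex point of the right half plane. -/
lemma integral_pow_mul_cexp_neg_mul (n : ℕ) {z : ℂ} (hz : 0 < z.re) :
    ∫ x in Set.Ioi (0 : ℝ), (x : ℂ) ^ n * Complex.exp (-(z * x)) = n.factorial / z ^ (n + 1) := by
  have hz0 : z ≠ 0 := fun h ↦ by simp [h] at hz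
  have hnorm (n : ℕ) {x : ℝ} (hx : 0 < x) :
      ‖(x : ℂ) ^ n * Complex.exp (-(z * x))‖ = x ^ n * Real.exp (-(z.re * x)) := by
    rw [norm_mul, norm_pow, Complex.norm_real, Real.norm_of_nonneg hx.le, Complex.norm_exp]
    simp
  have hint (n : ℕ) : IntegrableOn (fun x : ℝ ↦ (x : ℂ) ^ n * Complex.exp (-(z * x)))
      (Set.Ioi 0) := by
    refine Integrable.mono' (integrableOn_pow_mul_exp_neg_mul n hz)
      (Continuous.aestronglyMeasurable (by fun_prop)) ?_
    filter_upwards [self_mem_ae_restrict measurableSet_Ioi] with x hx using (hnorm n hx).le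
  have hexp (x : ℝ) : HasDerivAt (fun x : ℝ ↦ Complex.exp (-(z * x)))
      (Complex.exp (-(z * x)) * -z) x := by
    have h : HasDerivAt (fun x : ℝ ↦ -(z * (x : ℂ))) (-z) x := by
      simpa using ((Complex.ofRealCLM.hasDerivAt (x := x)).const_mul z).fun_neg
    exact h.cexp
  have hlim (n : ℕ) : Filter.Tendsto (fun x : ℝ ↦ (x : ℂ) ^ n * Complex.exp (-(z * x)))
      Filter.atTop (nhds 0) := by
    rw [tendsto_zero_iff_norm_tendsto_zero]
    refine (tendsto_rpow_mul_exp_neg_mul_atTop_nhds_zero n z.re hz).congr' ?_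
    filter_upwards [Filter.eventually_gt_atTop 0] with x hx
    rw [hnorm n hx, Real.rpow_natCast, neg_mul]
  induction n with
  | zero =>
    have h0 : IntegrableOn (fun x : ℝ ↦ Complex.exp (-(z * x))) (Set.Ioi 0) := by
      simpa using hint 0
    have := integral_Ioi_of_hasDerivAt_of_tendsto' (a := 0) (fun x _ ↦ hexp x)
      (Integrable.mul_const h0 (-z)) (by simpa using hlim 0)
    rw [integral_mul_const] at this
    simp only [Complex.ofReal_zero, mul_zero, neg_zero, Complex.exp_zero, zero_sub, mul_neg,
      neg_inj] at this
    simp only [pow_zero, one_mul, Nat.factorial_zero, Nat.cast_one, zero_add, pow_one]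
    exact eq_one_div_of_mul_eq_one_left this
  | succ n ih =>
    have hderiv (x : ℝ) : HasDerivAt (fun x : ℝ ↦ (x : ℂ) ^ (n + 1) * Complex.exp (-(z * x)))
        ((n + 1) * ((x : ℂ) ^ n * Complex.exp (-(z * x))) -
          z * ((x : ℂ) ^ (n + 1) * Complex.exp (-(z * x)))) x := by
      refine (((Complex.ofRealCLM.hasDerivAt (x := x)).fun_pow (n + 1)).fun_mul
        (hexp x)).congr_deriv ?_
      simp only [Complex.ofRealCLM_apply, Complex.ofReal_one, Nat.add_sub_cancel]
      push_cast
      ring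
    -- The function vanishes at both ends, so its derivative integrates to zero: `(n + 1) * I n = z
    -- * I (n + 1)`, where `I n` is the integral for exponent `n`.
    have := integral_Ioi_of_hasDerivAt_of_tendsto' (a := 0) (fun x _ ↦ hderiv x)
      (((hint n).const_mul _).sub ((hint (n + 1)).const_mul z)) (hlim (n + 1))
    rw [integral_sub ((hint n).const_mul _) ((hint (n + 1)).const_mul z), integral_const_mul,
      integral_const_mul, ih] at this
    simp only [Complex.ofReal_zero, ne_eq, Nat.add_eq_zero_iff, one_ne_zero, and_false,
      not_false_eq_true, zero_pow, zero_mul, sub_zero] at this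
    rw [sub_eq_zero] at this
    rw [← mul_right_inj' hz0, ← this, Nat.factorial_succ]
    push_cast
    field_simp
    ring

lemma integrable_id_gammaMeasure_succ (a : ℕ) {r : ℝ} (hr : 0 < r) :
    Integrable id (gammaMeasure ((a + 1 : ℕ) : ℝ) r) := by
  have hm : Measurable fun x ↦ ENNReal.ofReal (erlangDensity a r x) :=
    (continuous_erlangDensity a r).measurable.ennreal_ofReal
  rw [gammaMeasure_succ, integrable_withDensity_iff_integrable_smul' hm (by simp)]
  refine ((integrableOn_pow_mul_exp_neg_mul (a + 1) hr).const_mul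
    (r ^ (a + 1) / a.factorial)).congr ?_
  filter_upwards [self_mem_ae_restrict measurableSet_Ioi] with x hx
  rw [ENNReal.toReal_ofReal (erlangDensity_nonneg a hr.le (le_of_lt hx)), erlangDensity,
    smul_eq_mul, id]
  ring

/-- The Laplace transform above at `z = r - t * I`. The power form is what identifies a sum of
independent exponentials as Erlang. -/
lemma charFun_gammaMeasure_succ (a : ℕ) {r : ℝ} (hr : 0 < r) (t : ℝ) :
    charFun (gammaMeasure ((a + 1 : ℕ) : ℝ) r) t =
      ((r : ℂ) / (r - t * Complex.I)) ^ (a + 1) := by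
  have hm : Measurable fun x ↦ ENNReal.ofReal (erlangDensity a r x) :=
    (continuous_erlangDensity a r).measurable.ennreal_ofReal
  have hz : 0 < ((r : ℂ) - t * Complex.I).re := by simpa using hr
  rw [charFun_apply_real, gammaMeasure_succ,
    integral_withDensity_eq_integral_toReal_smul hm (by simp)]
  have : ∀ x ∈ Set.Ioi (0 : ℝ), (ENNReal.ofReal (erlangDensity a r x)).toReal •
      Complex.exp (t * x * Complex.I) = (r : ℂ) ^ (a + 1) / a.factorial *
        ((x : ℂ) ^ a * Complex.exp (-((r - t * Complex.I) * x))) := by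
    intro x hx
    have : Complex.exp (-((r - t * Complex.I) * x)) =
        Complex.exp (-(r * x)) * Complex.exp (t * x * Complex.I) := by
      rw [← Complex.exp_add]
      ring_nf
    rw [ENNReal.toReal_ofReal (erlangDensity_nonneg a hr.le (le_of_lt hx)), erlangDensity, this,
      Complex.real_smul]
    push_cast
    ring
  rw [setIntegral_congr_fun measurableSet_Ioi this, integral_const_mul,
    integral_pow_mul_cexp_neg_mul a hz, div_pow]
  have : (a.factorial : ℂ) ≠ 0 := mod_cast a.factorial_ne_zero
  field_simp

end Erlang

/-! ### Density and mean of order statistics of Erlang samples -/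

section ErlangOrderStatistics

/-- The `p`-th power of the Erlang tail, expanded in powers of `y`. -/
lemma erlangTail_pow (a p : ℕ) (y : ℝ) :
    erlangTail (a + 1) y ^ p =
      Real.exp (-(p * y)) * ∑ l ∈ Finset.range (a * p + 1), expCoeff (a + 1) p l * y ^ l := by
  set Q : Polynomial ℝ := ∑ i ∈ Finset.range (a + 1),
    Polynomial.C (1 / (i.factorial : ℝ)) * (Polynomial.X : Polynomial ℝ) ^ i with hQ
  -- The degree bound `a * p` is what makes the finite range in `l` contain every coefficient.
  have hdeg : (Q ^ p).natDegree < a * p + 1 := by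
    refine Nat.lt_succ_of_le (Polynomial.natDegree_pow_le.trans ?_)
    rw [mul_comm a p]
    refine Nat.mul_le_mul_left p (Polynomial.natDegree_sum_le_of_forall_le _ _ fun i hi ↦ ?_)
    exact (Polynomial.natDegree_C_mul_X_pow_le _ _).trans (Finset.mem_range_succ_iff.1 hi)
  have heval := Polynomial.eval_eq_sum_range' hdeg y
  rw [Polynomial.eval_pow] at heval
  have hQy : Q.eval y = ∑ i ∈ Finset.range (a + 1), y ^ i / (i.factorial : ℝ) := by
    rw [hQ, Polynomial.eval_finsetSum]
    refine Finset.sum_congr rfl fun i _ ↦ ?_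
    simp only [Polynomial.eval_mul, Polynomial.eval_C, Polynomial.eval_pow, Polynomial.eval_X]
    ring
  rw [erlangTail, mul_pow, ← hQy, heval, ← Real.exp_nat_mul]
  congr 2
  ring

/-- The density of the `(d + 1)`-th order statistic of `b + d + 1` i.i.d. Erlang variables. -/
noncomputable def erlangOrderStatDensity (a b d : ℕ) (r x : ℝ) : ℝ :=
  (b + d + 1 : ℕ) * ((b + d).choose d * (1 - erlangTail (a + 1) (r * x)) ^ d *
    erlangTail (a + 1) (r * x) ^ b) * erlangDensity a r x

lemma erlangOrderStatDensity_nonneg (a b d : ℕ) {r x : ℝ} (hr : 0 ≤ r) (hx : 0 ≤ x) :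
    0 ≤ erlangOrderStatDensity a b d r x := by
  have h1 := erlangTail_nonneg (a + 1) (mul_nonneg hr hx)
  have h2 := sub_nonneg.2 (erlangTail_le_one (a + 1) (mul_nonneg hr hx))
  have h3 := erlangDensity_nonneg a hr hx
  unfold erlangOrderStatDensity
  positivity

lemma continuous_erlangOrderStatDensity (a b d : ℕ) (r : ℝ) :
    Continuous (erlangOrderStatDensity a b d r) := by
  have h1 : Continuous (erlangTail (a + 1)) := by
    unfold erlangTail
    fun_prop
  have h2 := continuous_erlangDensity a r
  unfold erlangOrderStatDensity
  fun_prop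

/-- Chain rule with the telescoped Bernstein derivative. Here `b` counts the stragglers, `d + 1` is
the rank and `b + d + 1` the sample size, which avoids truncated subtraction. -/
lemma hasDerivAt_sum_bernsteinPolynomial_erlang (a b d : ℕ) (r x : ℝ) :
    HasDerivAt (fun x ↦ ∑ i ∈ Finset.Icc (d + 1) (b + d + 1),
      (bernsteinPolynomial ℝ (b + d + 1) i).eval (1 - erlangTail (a + 1) (r * x)))
      (erlangOrderStatDensity a b d r x) x := by
  simp_rw [← Polynomial.eval_finsetSum]
  refine ((Polynomial.hasDerivAt _ _).comp x (hasDerivAt_one_sub_erlangTail a r x)).congr_deriv ?_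
  rw [derivative_sum_Icc_bernsteinPolynomial (by omega) (by omega)]
  simp [bernsteinPolynomial, erlangOrderStatDensity]

/-- Only index `0` is nonzero at `0`, and it is excluded. This gives the value of the distribution
function at `0` and on the negative axis. -/
lemma sum_Icc_bernsteinPolynomial_eval_zero (n d : ℕ) :
    ∑ i ∈ Finset.Icc (d + 1) n, (bernsteinPolynomial ℝ n i).eval 0 = 0 := by
  refine Finset.sum_eq_zero fun i hi ↦ ?_
  rw [bernsteinPolynomial.eval_at_0, if_neg]
  have := (Finset.mem_Icc.1 hi).1
  omega

lemma map_orderStat_pi_gammaMeasure {ι : Type*} [Fintype ι] (a b d : ℕ)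
    (hι : Fintype.card ι = b + d + 1) {r : ℝ} (hr : 0 < r) :
    (Measure.pi fun _ : ι ↦ gammaMeasure ((a + 1 : ℕ) : ℝ) r).map (orderStat (d + 1)) =
      (volume.restrict (Set.Ioi 0)).withDensity
        fun x ↦ ENNReal.ofReal (erlangOrderStatDensity a b d r x) := by
  have : IsProbabilityMeasure (gammaMeasure ((a + 1 : ℕ) : ℝ) r) :=
    isProbabilityMeasure_gammaMeasure (by positivity) hr
  have hd : d + 1 ≤ Fintype.card ι := by omega
  refine Measure.ext_of_Iic _ _ fun t ↦ ?_
  rw [Measure.map_apply (measurable_orderStat (by omega) hd) measurableSet_Iic,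
    withDensity_Iic_of_hasDerivAt (hasDerivAt_sum_bernsteinPolynomial_erlang a b d r)
      (continuous_erlangOrderStatDensity a b d r)
      (by simpa [erlangTail_zero] using sum_Icc_bernsteinPolynomial_eval_zero (b + d + 1) d)
      (fun x hx ↦ erlangOrderStatDensity_nonneg a b d hr.le hx),
    ← ENNReal.ofReal_toReal (measure_ne_top _ _), ← measureReal_def,
    pi_real_orderStat_preimage_Iic _ (by omega) hd, gammaMeasure_succ_real_Iic a hr.le, hι]
  split_ifs with ht
  · rfl
  · rw [sum_Icc_bernsteinPolynomial_eval_zero]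

/-- Binomial expansion of `(1 - erlangTail) ^ d` collects tail powers `b + j`, which
`erlangTail_pow` expands. The density contributes one more exponential, hence the rate `(b + j + 1)
* r`, and the extra `x` raises the exponent to `a + 1 + l`. -/
lemma erlangOrderStatDensity_mul_self (a b d : ℕ) (r x : ℝ) :
    erlangOrderStatDensity a b d r x * x =
      ∑ j ∈ Finset.range (d + 1), ∑ l ∈ Finset.range (a * (b + j) + 1),
        ((b + d + 1 : ℕ) * (b + d).choose d / a.factorial * ((-1) ^ j * d.choose j *
          (expCoeff (a + 1) (b + j) l * r ^ (a + 1 + l)))) *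
        (x ^ (a + 1 + l) * Real.exp (-((b + j + 1) * r * x))) := by
  have hpow : (1 - erlangTail (a + 1) (r * x)) ^ d =
      ∑ j ∈ Finset.range (d + 1), (-1) ^ j * d.choose j * erlangTail (a + 1) (r * x) ^ j := by
    rw [sub_eq_neg_add, add_pow]
    refine Finset.sum_congr rfl fun j _ ↦ ?_
    rw [neg_pow]
    ring
  have hj (j : ℕ) : erlangTail (a + 1) (r * x) ^ j * erlangTail (a + 1) (r * x) ^ b =
      Real.exp (-((b + j) * (r * x))) *
        ∑ l ∈ Finset.range (a * (b + j) + 1), expCoeff (a + 1) (b + j) l * (r * x) ^ l := by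
    rw [← pow_add, add_comm j b, erlangTail_pow]
    push_cast
    rfl
  have hexp (j : ℕ) : Real.exp (-((b + j + 1) * r * x)) =
      Real.exp (-((b + j) * (r * x))) * Real.exp (-(r * x)) := by
    rw [← Real.exp_add]
    ring_nf
  rw [erlangOrderStatDensity, erlangDensity, hpow]
  calc _ = ∑ j ∈ Finset.range (d + 1), (b + d + 1 : ℕ) * (b + d).choose d / a.factorial *
        ((-1) ^ j * d.choose j * (erlangTail (a + 1) (r * x) ^ j * erlangTail (a + 1) (r * x) ^ b))
          * ((r * x) ^ (a + 1) * Real.exp (-(r * x))) := by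
        rw [Finset.mul_sum, Finset.sum_mul, Finset.mul_sum, Finset.sum_mul, Finset.sum_mul]
        refine Finset.sum_congr rfl fun j _ ↦ ?_
        ring
    _ = _ := by
        refine Finset.sum_congr rfl fun j _ ↦ ?_
        rw [hj, Finset.mul_sum, Finset.mul_sum, Finset.mul_sum, Finset.sum_mul]
        refine Finset.sum_congr rfl fun l _ ↦ ?_
        rw [hexp]
        ring

lemma integral_erlangOrderStatDensity_mul_self (a b d : ℕ) {r : ℝ} (hr : 0 < r) :
    ∫ x in Set.Ioi (0 : ℝ), erlangOrderStatDensity a b d r x * x =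
      PhiI (b + d + 1) b (a + 1) r := by
  have hb (j : ℕ) : 0 < ((b : ℝ) + j + 1) * r := by positivity
  -- Converts the density constant `n * (n - 1).choose d` into the prefactor `(n - ns) * n.choose
  -- ns` of `PhiI`.
  have hchoose : (d + 1) * (b + d + 1).choose b = (b + d + 1) * (b + d).choose d := by
    rw [Nat.add_one_mul_choose_eq, mul_comm, ← Nat.choose_symm_of_eq_add (a := d + 1) (b := b)]
    omega
  simp_rw [erlangOrderStatDensity_mul_self]
  rw [integral_finsetSum _ fun j _ ↦ integrable_finsetSum _ fun l _ ↦
    (integrableOn_pow_mul_exp_neg_mul _ (hb j)).const_mul _]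
  rw [PhiI, show b + d + 1 - b = d + 1 by omega, Finset.mul_sum]
  refine Finset.sum_congr rfl fun j _ ↦ ?_
  rw [integral_finsetSum _ fun l _ ↦ (integrableOn_pow_mul_exp_neg_mul _ (hb j)).const_mul _,
    Finset.mul_sum, Finset.mul_sum]
  refine Finset.sum_congr (by simp) fun l _ ↦ ?_
  have hb1 : (b : ℝ) + j + 1 ≠ 0 := by positivity
  rw [integral_const_mul, integral_pow_mul_exp_neg_mul _ (hb j), mul_pow, Nat.add_sub_cancel,
    Nat.add_sub_cancel, ← Nat.cast_mul (d + 1), hchoose]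
  push_cast
  have := a.factorial_ne_zero
  field_simp
  ring

/-- The mean of an order statistic of i.i.d. Erlang variables. -/
lemma integral_orderStat_pi_gammaMeasure {ι : Type*} [Fintype ι] (a : ℕ) {ns : ℕ}
    (hns : ns < Fintype.card ι) {r : ℝ} (hr : 0 < r) :
    ∫ x : ι → ℝ, orderStat (Fintype.card ι - ns) x
        ∂(Measure.pi fun _ : ι ↦ gammaMeasure ((a + 1 : ℕ) : ℝ) r) =
      PhiI (Fintype.card ι) ns (a + 1) r := by
  obtain ⟨d, hd⟩ := Nat.exists_eq_add_of_lt hns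
  rw [hd, show ns + d + 1 - ns = d + 1 by omega,
    ← integral_erlangOrderStatDensity_mul_self a ns d hr]
  have hmeas : Measurable (orderStat (d + 1) : (ι → ℝ) → ℝ) :=
    measurable_orderStat (by omega) (by omega)
  have hm : Measurable fun x ↦ ENNReal.ofReal (erlangOrderStatDensity a ns d r x) :=
    (continuous_erlangOrderStatDensity a ns d r).measurable.ennreal_ofReal
  rw [← integral_map (φ := orderStat (d + 1)) (f := fun t : ℝ ↦ t) hmeas.aemeasurable
      aestronglyMeasurable_id, map_orderStat_pi_gammaMeasure a ns d hd hr,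
    integral_withDensity_eq_integral_toReal_smul hm (by simp)]
  refine setIntegral_congr_fun measurableSet_Ioi fun x hx ↦ ?_
  simp only [smul_eq_mul]
  rw [ENNReal.toReal_ofReal (erlangOrderStatDensity_nonneg a ns d hr.le (le_of_lt hx))]

lemma isProbabilityMeasure_shiftedErlang (a : ℕ) {r : ℝ} (hr : 0 < r) (σ : ℝ) :
    IsProbabilityMeasure (shiftedErlang (a + 1) r σ) := by
  have : IsProbabilityMeasure (gammaMeasure ((a + 1 : ℕ) : ℝ) r) :=
    isProbabilityMeasure_gammaMeasure (by positivity) hr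
  exact Measure.isProbabilityMeasure_map (by fun_prop)

lemma integrable_id_shiftedErlang (a : ℕ) {r : ℝ} (hr : 0 < r) (σ : ℝ) :
    Integrable id (shiftedErlang (a + 1) r σ) := by
  have : IsProbabilityMeasure (gammaMeasure ((a + 1 : ℕ) : ℝ) r) :=
    isProbabilityMeasure_gammaMeasure (by positivity) hr
  rw [shiftedErlang, integrable_map_measure aestronglyMeasurable_id (by fun_prop)]
  exact (integrable_const σ).add (integrable_id_gammaMeasure_succ a hr)

/-- With a nonnegative shift this makes the worker totals almost surely nonnegative, which is why
slowing the rates down can only raise them. -/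
lemma ae_le_shiftedErlang (a : ℕ) (r σ : ℝ) : ∀ᵐ x ∂shiftedErlang (a + 1) r σ, σ ≤ x := by
  have hm : Measurable fun x ↦ ENNReal.ofReal (erlangDensity a r x) :=
    (continuous_erlangDensity a r).measurable.ennreal_ofReal
  rw [shiftedErlang, ae_map_iff (by fun_prop) measurableSet_Ici, gammaMeasure_succ,
    ae_withDensity_iff hm]
  filter_upwards [self_mem_ae_restrict measurableSet_Ioi] with x hx _
  exact le_add_of_nonneg_right (le_of_lt hx)

lemma integrable_orderStat_pi_shiftedErlang {ι : Type*} [Fintype ι] (a : ℕ) {d : ℕ} (hd : 1 ≤ d)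
    (hdn : d ≤ Fintype.card ι) {r : ℝ} (hr : 0 < r) (σ : ℝ) :
    Integrable (fun x : ι → ℝ ↦ orderStat d x)
      (Measure.pi fun _ : ι ↦ shiftedErlang (a + 1) r σ) := by
  have := isProbabilityMeasure_shiftedErlang a hr σ
  exact integrable_orderStat_comp hd hdn fun i ↦
    integrable_comp_eval (μ := fun _ : ι ↦ shiftedErlang (a + 1) r σ) (f := id)
      (integrable_id_shiftedErlang a hr σ)

lemma integral_orderStat_pi_shiftedErlang {ι : Type*} [Fintype ι] (a : ℕ) {ns : ℕ}
    (hns : ns < Fintype.card ι) {r : ℝ} (hr : 0 < r) (σ : ℝ) :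
    ∫ x : ι → ℝ, orderStat (Fintype.card ι - ns) x
        ∂(Measure.pi fun _ : ι ↦ shiftedErlang (a + 1) r σ) =
      σ + PhiI (Fintype.card ι) ns (a + 1) r := by
  have : IsProbabilityMeasure (gammaMeasure ((a + 1 : ℕ) : ℝ) r) :=
    isProbabilityMeasure_gammaMeasure (by positivity) hr
  have hd : 1 ≤ Fintype.card ι - ns := by omega
  have hdn : Fintype.card ι - ns ≤ Fintype.card ι := by omega
  have hint : Integrable (fun x : ι → ℝ ↦ orderStat (Fintype.card ι - ns) x)
      (Measure.pi fun _ : ι ↦ gammaMeasure ((a + 1 : ℕ) : ℝ) r) :=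
    integrable_orderStat_comp hd hdn fun i ↦
      integrable_comp_eval (μ := fun _ : ι ↦ gammaMeasure ((a + 1 : ℕ) : ℝ) r) (f := id)
        (integrable_id_gammaMeasure_succ a hr)
  simp_rw [shiftedErlang]
  rw [← Measure.pi_map_pi (fun _ ↦ by fun_prop), integral_map
    (Measurable.aemeasurable (by fun_prop))
    (measurable_orderStat hd hdn).aestronglyMeasurable]
  simp_rw [orderStat_const_add hd hdn]
  rw [integral_add (integrable_const _) hint, integral_const, probReal_univ, one_smul]
  congr 1
  exact integral_orderStat_pi_gammaMeasure a hns hr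

end ErlangOrderStatistics

/-! ### Service times: rescaling to the fastest cluster and comparison -/

section ServiceTimes

variable {Ω : Type*} [MeasurableSpace Ω] {μ : Measure Ω}

/-- The rows of an independent array are independent. -/
lemma ProbabilityTheory.iIndepFun.row {ι κ 𝓧 : Type*} [Countable ι] [Countable κ]
    [MeasurableSpace 𝓧] {X : ι → κ → Ω → 𝓧} (hX : ∀ i j, AEMeasurable (X i j) μ)
    (h : iIndepFun (fun p : ι × κ ↦ X p.1 p.2) μ) : iIndepFun (fun i ω j ↦ X i j ω) μ := by
  have := h.isProbabilityMeasure
  have hprob (i : ι) (j : κ) : IsProbabilityMeasure (μ.map (X i j)) :=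
    Measure.isProbabilityMeasure_map (hX i j)
  have hrow (i : ι) : AEMeasurable (fun ω j ↦ X i j ω) μ := aemeasurable_pi_lambda _ (hX i)
  have hjoint := h.map_fun_eq_infinitePi_map₀' fun p : ι × κ ↦ hX p.1 p.2
  rw [iIndepFun_iff_map_fun_eq_infinitePi_map₀' hrow]
  have hi (i : ι) : μ.map (fun ω j ↦ X i j ω) = Measure.infinitePi fun j ↦ μ.map (X i j) :=
    (h.precomp (g := fun j ↦ (i, j))
      (Prod.mk_right_injective i)).map_fun_eq_infinitePi_map₀' (hX i)
  simp_rw [hi]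
  -- The joint law of the rows is the curried joint law of the array, and currying a product measure
  -- over pairs gives a product of products.
  rw [← Measure.infinitePi_map_curry (fun i j ↦ μ.map (X i j)), ← hjoint,
    AEMeasurable.map_map_of_aemeasurable (by fun_prop)
      (aemeasurable_pi_lambda _ fun p : ι × κ ↦ hX p.1 p.2)]
  rfl

lemma charFun_shiftedExp {r : ℝ} (hr : 0 < r) (s t : ℝ) :
    charFun (shiftedExp s r) t =
      (r : ℂ) / (r - t * Complex.I) * Complex.exp (t * s * Complex.I) := by
  rw [shiftedExp, expMeasure, charFun_map_const_add]
  have := charFun_gammaMeasure_succ 0 hr t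
  simp only [zero_add, Nat.cast_one, pow_one] at this
  rw [this]
  simp

lemma charFun_shiftedErlang (a : ℕ) {r : ℝ} (hr : 0 < r) (s t : ℝ) :
    charFun (shiftedErlang (a + 1) r s) t =
      ((r : ℂ) / (r - t * Complex.I)) ^ (a + 1) * Complex.exp (t * s * Complex.I) := by
  rw [shiftedErlang, charFun_map_const_add, charFun_gammaMeasure_succ a hr t]
  simp

/-- A rescaled sum of i.i.d. shifted exponential variables is a shifted Erlang variable. -/
lemma hasLaw_mul_sum_shiftedExp {a : ℕ} {X : Fin (a + 1) → Ω → ℝ} {s r b : ℝ} (hr : 0 < r)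
    (hb : 0 < b) (hX : ∀ j, HasLaw (X j) (shiftedExp s (b * r)) μ) (h : iIndepFun X μ) :
    HasLaw (fun ω ↦ b * ∑ j, X j ω)
      (shiftedErlang (a + 1) r ((a + 1 : ℕ) * (b * s))) μ where
  aemeasurable := by
    have := fun j ↦ (hX j).aemeasurable
    fun_prop
  map_eq := by
    have := h.isProbabilityMeasure
    have := isProbabilityMeasure_shiftedErlang a hr ((a + 1 : ℕ) * (b * s))
    have hm := fun j ↦ (hX j).aemeasurable
    have hsum : AEMeasurable (fun ω ↦ ∑ j, X j ω) μ := by fun_prop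
    -- Scaling by `b` evaluates the characteristic functions at `b * t`, and `b` then cancels
    -- against the rate `b * r`.
    refine Measure.ext_of_charFun (funext fun t ↦ ?_)
    rw [charFun_map_mul_comp hsum, h.charFun_map_fun_sum_eq_prod hm, Finset.prod_apply,
      charFun_shiftedErlang a hr]
    simp_rw [(hX _).map_eq, charFun_shiftedExp (mul_pos hb hr)]
    rw [Finset.prod_const, Finset.card_univ, Fintype.card_fin, mul_pow, ← Complex.exp_nat_mul]
    have hb0 : (b : ℂ) ≠ 0 := mod_cast hb.ne'
    congr 2
    · push_cast
      rw [mul_assoc (b : ℂ) t, ← mul_sub, mul_div_mul_left _ _ hb0]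
    · push_cast
      ring

lemma one_le_numTasks {m k mI kI : ℕ} (hm : 1 ≤ m) (hk : 1 ≤ k) (hmI : 1 ≤ mI) (hkI : 1 ≤ kI) :
    1 ≤ numTasks m k mI kI := by
  have h (x y : ℕ) (hx : 1 ≤ x) (hy : 1 ≤ y) : 0 < ⌈(x : ℝ) / (y : ℝ)⌉₊ :=
    Nat.ceil_pos.2 (by positivity)
  exact Nat.mul_pos (h m mI hm hmI) (h k kI hk hkI)

lemma one_div_mul_le_numTasks_div {m k mI kI : ℕ} (hm : 1 ≤ m) (hk : 1 ≤ k) (s : ℝ) (hs : 0 ≤ s) :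
    s / ((kI : ℝ) * mI) ≤ numTasks m k mI kI * (s / ((k : ℝ) * m)) := by
  have hkm : (0 : ℝ) < (k : ℝ) * m := by positivity
  have h : (m : ℝ) / mI * (k / kI) ≤ numTasks m k mI kI := by
    rw [numTasks, Nat.cast_mul]
    gcongr <;> exact Nat.le_ceil _
  calc s / ((kI : ℝ) * mI) = (m : ℝ) / mI * (k / kI) * (s / ((k : ℝ) * m)) := by
        field_simp
    _ ≤ _ := by gcongr

variable {c : ℕ} [NeZero c] {size : Fin c → ℕ} {m k a : ℕ} {s lam : Fin c → ℝ}

/-- The times of the workers, slowed down to the pace of the fastest cluster, are i.i.d. shifted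
Erlang variables. -/
lemma AdditiveServiceTime.map_scaled_workerTime (hm : 1 ≤ m) (hk : 1 ≤ k)
    (hlam : ∀ u, 0 < lam u) (htm : ∀ u, lam u * s u = lam 0 * s 0)
    {X : Worker size → Fin (a + 1) → Ω → ℝ} (hX : AdditiveServiceTime size m k (a + 1) s lam μ X) :
    (∀ w, HasLaw (fun ω ↦ lam w.1 / lam 0 * workerTime X w ω)
      (shiftedErlang (a + 1) (lam 0 * k * m) ((a + 1 : ℕ) * (s 0 / ((k : ℝ) * m)))) μ) ∧
    μ.map (fun ω w ↦ lam w.1 / lam 0 * workerTime X w ω) =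
      Measure.pi fun _ : Worker size ↦
        shiftedErlang (a + 1) (lam 0 * k * m) ((a + 1 : ℕ) * (s 0 / ((k : ℝ) * m))) := by
  have h0 := hlam 0
  have haem (w : Worker size) (j : Fin (a + 1)) := (hX.law w j).aemeasurable
  have hlaw (w : Worker size) : HasLaw (fun ω ↦ lam w.1 / lam 0 * workerTime X w ω)
      (shiftedErlang (a + 1) (lam 0 * k * m) ((a + 1 : ℕ) * (s 0 / ((k : ℝ) * m)))) μ := by
    have hrate : lam w.1 * k * m = lam w.1 / lam 0 * (lam 0 * k * m) := by
      field_simp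
    -- Constancy of `lam u * s u` enters here: the rescaled shifts agree across clusters.
    have hshift : s 0 / ((k : ℝ) * m) = lam w.1 / lam 0 * (s w.1 / ((k : ℝ) * m)) := by
      rw [div_mul_div_comm, htm, mul_div_mul_left _ _ h0.ne']
    rw [hshift]
    exact hasLaw_mul_sum_shiftedExp (by positivity) (div_pos (hlam _) h0)
      (fun j ↦ hrate ▸ hX.law w j)
      (hX.indep.precomp (g := fun j ↦ (w, j)) (Prod.mk_right_injective w))
  refine ⟨hlaw, ?_⟩
  have hind : iIndepFun (fun (w : Worker size) ω ↦ lam w.1 / lam 0 * workerTime X w ω) μ :=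
    (hX.indep.row haem).comp₀ (fun w x ↦ lam w.1 / lam 0 * ∑ j, x j)
      (fun w ↦ aemeasurable_pi_lambda _ (haem w))
      (fun w ↦ Measurable.aemeasurable (by fun_prop))
  rw [hind.map_fun_eq_pi_map fun w ↦ (hlaw w).aemeasurable]
  simp_rw [fun w ↦ (hlaw w).map_eq]

/-- The waiting time is integrable and its mean is at least that of the order statistic of the
slowed down times. -/
lemma AdditiveServiceTime.integrable_waitingTimeKES_and_le [IsProbabilityMeasure μ]
    (hm : 1 ≤ m) (hk : 1 ≤ k)
    (hs : ∀ u, 0 ≤ s u) (hlam : ∀ u, 0 < lam u) (hfast : ∀ u, lam u ≤ lam 0)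
    (htm : ∀ u, lam u * s u = lam 0 * s 0) {ns : ℕ} (hns : ns < ∑ u, size u)
    {X : Worker size → Fin (a + 1) → Ω → ℝ} (hX : AdditiveServiceTime size m k (a + 1) s lam μ X) :
    Integrable (waitingTimeKES ns X) μ ∧
    (a + 1 : ℕ) * (s 0 / ((k : ℝ) * m)) + PhiI (∑ u, size u) ns (a + 1) (lam 0 * k * m) ≤
      ∫ ω, waitingTimeKES ns X ω ∂μ := by
  have h0 := hlam 0
  have hr : 0 < lam 0 * k * m := by positivity
  set σ : ℝ := (a + 1 : ℕ) * (s 0 / ((k : ℝ) * m)) with hσ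
  have hσ0 : 0 ≤ σ := by
    have := hs 0
    positivity
  obtain ⟨hlaw, hmap⟩ := hX.map_scaled_workerTime hm hk hlam htm
  have hcard : Fintype.card (Worker size) = ∑ u, size u := by simp
  have hd : 1 ≤ ∑ u, size u - ns := by omega
  have hdn : ∑ u, size u - ns ≤ Fintype.card (Worker size) := by omega
  have hYint (w : Worker size) : Integrable (fun ω ↦ lam w.1 / lam 0 * workerTime X w ω) μ := by
    refine ((hlaw w).map_eq ▸ integrable_id_shiftedErlang a hr σ :
      Integrable id (μ.map _)).comp_aemeasurable (hlaw w).aemeasurable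
  have hTint (w : Worker size) : Integrable (workerTime X w) μ := by
    refine ((hYint w).const_mul (lam 0 / lam w.1)).congr (.of_forall fun ω ↦ ?_)
    have := (hlam w.1).ne'
    dsimp only
    field_simp
  have hWint : Integrable (waitingTimeKES ns X) μ := integrable_orderStat_comp hd hdn hTint
  refine ⟨hWint, ?_⟩
  have hle : ∀ᵐ ω ∂μ, ∀ w, lam w.1 / lam 0 * workerTime X w ω ≤ workerTime X w ω := by
    refine ae_all_iff.2 fun w ↦ ?_
    have h := ae_of_ae_map (hlaw w).aemeasurable
      ((hlaw w).map_eq ▸ ae_le_shiftedErlang a (lam 0 * k * m) σ)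
    filter_upwards [h] with ω hω
    -- The rescaled total is at least `σ ≥ 0`, and the scaling factor is positive.
    have hT : 0 ≤ workerTime X w ω :=
      nonneg_of_mul_nonneg_right (hσ0.trans hω) (div_pos (hlam _) h0)
    exact mul_le_of_le_one_left hT ((div_le_one h0).2 (hfast _))
  have hmean := integral_orderStat_pi_shiftedErlang (ι := Worker size) a
    (hcard ▸ hns) hr σ
  rw [hcard, ← hmap, integral_map (aemeasurable_pi_lambda _ fun w ↦ (hlaw w).aemeasurable)
    (measurable_orderStat hd hdn).aestronglyMeasurable] at hmean
  rw [← hmean]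
  refine integral_mono_ae (integrable_orderStat_comp hd hdn hYint) hWint ?_
  filter_upwards [hle] with ω hω using orderStat_mono hd hdn hω

end ServiceTimes

/-! ### The lower bound for the mean waiting time -/

theorem corollary2 {c : ℕ} [NeZero c] (size : Fin c → ℕ) (m k mI kI n ns : ℕ)
    (hm : 1 ≤ m) (hk : 1 ≤ k) (hmI : 1 ≤ mI) (hkI : 1 ≤ kI)
    (hn : n = ∑ u, size u) (hns : ns < n)
    (s lam : Fin c → ℝ) (tm : ℝ)
    (hs : ∀ u, 0 ≤ s u) (hlam : ∀ u, 0 < lam u)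
    (hfast : ∀ u, lam u ≤ lam 0) (htm : ∀ u, lam u * s u = tm)
    {Ω : Type*} [MeasurableSpace Ω] (μ : Measure Ω) [IsProbabilityMeasure μ]
    (X : Worker size → Fin (numTasks m k mI kI) → Ω → ℝ)
    (hX : AdditiveServiceTime size m k (numTasks m k mI kI) s lam μ X) :
    Integrable (waitingTimeKES ns X) μ ∧
    s 0 / ((kI : ℝ) * mI) + PhiI n ns (numTasks m k mI kI) (lam 0 * k * m)
      ≤ ∫ ω, waitingTimeKES ns X ω ∂μ ∧
    ((∀ σ : ℝ,
      Integrable (fun x : Fin n → ℝ => orderStat (n - ns) x)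
        (Measure.pi fun _ : Fin n =>
          shiftedErlang (numTasks m k mI kI) (lam 0 * k * m) σ) ∧
      ∫ x : Fin n → ℝ, orderStat (n - ns) x
        ∂(Measure.pi fun _ : Fin n =>
          shiftedErlang (numTasks m k mI kI) (lam 0 * k * m) σ)
        = σ + PhiI n ns (numTasks m k mI kI) (lam 0 * k * m)) ∧
    ∫ x : Fin n → ℝ, orderStat (n - ns) x
        ∂(Measure.pi fun _ : Fin n =>
          shiftedErlang (numTasks m k mI kI) (lam 0 * k * m)
            (numTasks m k mI kI * (s 0 / ((k : ℝ) * m))))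
      ≤ ∫ ω, waitingTimeKES ns X ω ∂μ) := by

  obtain ⟨a, ha⟩ := Nat.exists_eq_add_of_le' (one_le_numTasks hm hk hmI hkI)
  have hshift := one_div_mul_le_numTasks_div (mI := mI) (kI := kI) hm hk (s 0) (hs 0)
  -- The type of `X` depends on the number of tasks, so it is reverted before that number is
  -- replaced by `a + 1`; `hshift` keeps the only further fact needed about the ceilings.
  revert X
  generalize numTasks m k mI kI = τ at ha hshift
  subst ha
  intro X hX
  subst hn
  have h0 := hlam 0
  have hr : 0 < lam 0 * k * m := by positivity
  obtain ⟨hint, hle⟩ := hX.integrable_waitingTimeKES_and_le hm hk hs hlam hfast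
    (fun u ↦ (htm u).trans (htm 0).symm) hns
  have hmean (σ : ℝ) : ∫ x : Fin (∑ u, size u) → ℝ, orderStat (∑ u, size u - ns) x
      ∂(Measure.pi fun _ : Fin (∑ u, size u) ↦ shiftedErlang (a + 1) (lam 0 * k * m) σ) =
        σ + PhiI (∑ u, size u) ns (a + 1) (lam 0 * k * m) := by
    simpa using integral_orderStat_pi_shiftedErlang (ι := Fin (∑ u, size u)) a
      (by simpa using hns) hr σ
  refine ⟨hint, (add_le_add_left hshift _).trans hle, fun σ ↦ ⟨?_, hmean σ⟩, (hmean _).trans_le hle⟩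
  exact integrable_orderStat_pi_shiftedErlang a (by omega) (by simp) hr σ
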